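/- For integers $1\le d\le N$ let $\mu_{d,N}$ be the Haar measure on the Grassmann manifold $G_{d,N}$, that is, the rotation invariant Borel probability measure on the set of all $d$-dimensional linear subspaces of $\mathbb{R}^N$. For $E\in G_{d,N}$ denote by $\ell_\infty^N|_E$ the space $E$ with the norm inherited from $\ell_\infty^N$, and by $\ell_1^N/E^\perp$ the quotient of $\ell_1^N$ by the orthogonal complement of $E$, with the quotient norm. There exist universal constants $C,c>0$ and $\varepsilon\in(0,1)$ such that, for all integers $d\ge 1$ and $N\ge d^2$, $$\mu_{d,N}\{E\in G_{d,N} : \ell_1^N/E^\perp \text{ has property } (\ast)\}\ \ge\ 1-\varepsilon^d$$ and $$\mu_{d,N}\{E\in G_{d,N} : \ell_\infty^N|_E \text{ has property } (\ast)\}\ \ge\ 1-\varepsilon^d ,$$ where a normed space $X$ has property $(\ast)$ if it contains a linear subspace $G$ of some dimension $h\ge\min\{c\log N,\,d\}$ such that (i) $\mathrm{d}(\ell_2^h,G)\le C$, where $\mathrm{d}(Y,Z)=\inf\{\|T\|\,\|T^{-1}\| : T:Y\to Z \text{ a linear isomorphism}\}$ is the Banach–Mazur distance; (ii) $G$ is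 $C$-complemented in $X$, i.e. there is a linear projection $P$ of $X$ onto $G$ with $\|P\|\le C$. -/

import Mathlib

open MeasureTheory
open scoped ENNReal

noncomputable section

namespace GenericSpaces

/-- The Euclidean space `ℝ^N`. -/
abbrev Euc (N : ℕ) : Type := EuclideanSpace ℝ (Fin N)

/-! ### The orthogonal group and its normalized Haar measure -/

/-- The orthogonal group `O(N)`: the operators `U` on Euclidean `ℝ^N` with `U* U = U U* = 1`. -/
abbrev OrthGroup (N : ℕ) : Type := unitary (Euc N →L[ℝ] Euc N)

instance (N : ℕ) : ContinuousStar (Euc N →L[ℝ] Euc N) :=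
  ⟨(ContinuousLinearMap.adjoint (𝕜 := ℝ) (E := Euc N) (F := Euc N)).continuous⟩

instance (N : ℕ) : CompactSpace (OrthGroup N) := by
  have hb : Bornology.IsBounded (unitary (Euc N →L[ℝ] Euc N) : Set (Euc N →L[ℝ] Euc N)) := by
    refine (Metric.isBounded_closedBall (x := (0 : Euc N →L[ℝ] Euc N)) (r := 1)).subset ?_
    intro U hU
    rw [mem_closedBall_zero_iff]
    refine ContinuousLinearMap.opNorm_le_bound _ zero_le_one fun x => ?_
    have h := (Unitary.linearIsometryEquiv (⟨U, hU⟩ : OrthGroup N)).norm_map x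
    rw [one_mul]
    exact le_of_eq h
  exact isCompact_iff_compactSpace.mp (Metric.isCompact_of_isClosed_isBounded isClosed_unitary hb)

/-- The Haar probability measure of the orthogonal group `O(N)`. -/
def orthHaar (N : ℕ) : Measure (OrthGroup N) :=
  Measure.haarMeasure (⊤ : TopologicalSpace.PositiveCompacts (OrthGroup N))

instance (N : ℕ) : IsProbabilityMeasure (orthHaar N) :=
  ⟨by
    have h := Measure.haarMeasure_self
      (K₀ := (⊤ : TopologicalSpace.PositiveCompacts (OrthGroup N)))
    simpa [orthHaar] using h⟩

/-! ### The Grassmann manifold and its Haar measure -/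

/-- The Grassmann manifold `G_{d,N}` of all `d`-dimensional linear subspaces of `ℝ^N`. -/
def Grass (d N : ℕ) : Type := {E : Submodule ℝ (Euc N) // Module.finrank ℝ E = d}

/-- The usual topology of `G_{d,N}`: a subspace is identified with the orthogonal projection
onto it, and the distance is the operator norm. -/
instance (d N : ℕ) : TopologicalSpace (Grass d N) :=
  TopologicalSpace.induced (fun E : Grass d N => E.1.starProjection) inferInstance

/-- The Borel sets of `G_{d,N}`. -/
instance (d N : ℕ) : MeasurableSpace (Grass d N) := borel _

instance (d N : ℕ) : BorelSpace (Grass d N) := ⟨rfl⟩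

/-- The image `U E` of the subspace `E` under the orthogonal map `U`. -/
def rotate {d N : ℕ} (U : OrthGroup N) (E : Grass d N) : Grass d N :=
  ⟨E.1.map ((Unitary.linearIsometryEquiv U).toLinearEquiv : Euc N →ₗ[ℝ] Euc N),
    (LinearEquiv.finrank_map_eq _ _).trans E.2⟩

/-- The coordinate subspace of `ℝ^N` spanned by the first `d` unit vectors. -/
def coordSubspace {d N : ℕ} (h : d ≤ N) : Grass d N :=
  ⟨Submodule.span ℝ (Set.range fun i : Fin d =>
      (EuclideanSpace.basisFun (Fin N) ℝ) (Fin.castLE h i)), by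
    have hli : LinearIndependent ℝ fun i : Fin d =>
        (EuclideanSpace.basisFun (Fin N) ℝ) (Fin.castLE h i) :=
      (EuclideanSpace.basisFun (Fin N) ℝ).orthonormal.linearIndependent.comp _
        (Fin.castLE_injective h)
    simpa using finrank_span_eq_card hli⟩

/-- The Haar measure `μ_{d,N}` on the Grassmann manifold, i.e. the rotation invariant Borel
probability measure: the law of `U E₀` for a Haar distributed `U ∈ O(N)` and a fixed
`d`-dimensional subspace `E₀` of `ℝ^N`. -/
def grassHaar {d N : ℕ} (h : d ≤ N) : Measure (Grass d N) :=
  (orthHaar N).map fun U => rotate U (coordSubspace h)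

/-- The orbit map is continuous, so that the image measure above is a genuine one. -/
theorem continuous_rotate {d N : ℕ} (E : Grass d N) :
    Continuous fun U : OrthGroup N => rotate U E := by
  refine continuous_induced_rng.mpr ?_
  have h : ((fun E : Grass d N => E.1.starProjection) ∘ fun U : OrthGroup N => rotate U E)
      = fun U : OrthGroup N =>
        (U : Euc N →L[ℝ] Euc N) * (E.1.starProjection * (star U : OrthGroup N)) := by
    funext U
    ext1 x
    exact Submodule.starProjection_map_apply (Unitary.linearIsometryEquiv U) E.1 x
  rw [h]
  exact continuous_subtype_val.mul
    (continuous_const.mul (continuous_subtype_val.comp continuous_star))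

instance {d N : ℕ} (h : d ≤ N) : IsProbabilityMeasure (grassHaar h) :=
  Measure.isProbabilityMeasure_map (continuous_rotate _).measurable.aemeasurable

/-! ### The subspace of `ℓ_∞^N` and the quotient of `ℓ_1^N` given by a point of `G_{d,N}` -/

/-- `E` as a subspace of `ℓ_∞^N`; the type `Fin N → ℝ` carries the maximum norm. -/
def linftySubspace {d N : ℕ} (E : Grass d N) : Submodule ℝ (Fin N → ℝ) :=
  E.1.map (WithLp.linearEquiv 2 ℝ (Fin N → ℝ) : Euc N →ₗ[ℝ] (Fin N → ℝ))

/-- `E^⊥`, the orthogonal complement of `E` in `ℝ^N`, as a subspace of `ℓ_1^N`. -/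
def perpInLOne {d N : ℕ} (E : Grass d N) : Submodule ℝ (PiLp 1 fun _ : Fin N => ℝ) :=
  E.1ᗮ.map ((WithLp.linearEquiv 2 ℝ (Fin N → ℝ)).trans
    (WithLp.linearEquiv 1 ℝ (Fin N → ℝ)).symm : Euc N →ₗ[ℝ] PiLp 1 fun _ : Fin N => ℝ)

/-- The quotient `ℓ_1^N / E^⊥` with the quotient norm; its dual is `E ⊆ ℓ_∞^N`. -/
abbrev LOneQuotient {d N : ℕ} (E : Grass d N) : Type :=
  (PiLp 1 fun _ : Fin N => ℝ) ⧸ perpInLOne E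

/-! ### Banach-Mazur distance and complemented subspaces -/

/-- The Banach-Mazur distance `inf ‖T‖ ‖T⁻¹‖` over all isomorphisms `T : X → Y`
(infinite if there is none). -/
def banachMazur (X Y : Type) [SeminormedAddCommGroup X] [NormedSpace ℝ X]
    [SeminormedAddCommGroup Y] [NormedSpace ℝ Y] : ℝ≥0∞ :=
  ⨅ T : X ≃L[ℝ] Y, ENNReal.ofReal (‖(T : X →L[ℝ] Y)‖ * ‖(T.symm : Y →L[ℝ] X)‖)

/-- `G` is `C`-complemented in `X`: it is the range of a linear projection of norm at most `C`. -/
def IsComplemented {X : Type} [SeminormedAddCommGroup X] [NormedSpace ℝ X]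
    (G : Submodule ℝ X) (C : ℝ) : Prop :=
  ∃ P : X →L[ℝ] X, P ∘L P = P ∧ LinearMap.range (P : X →ₗ[ℝ] X) = G ∧ ‖P‖ ≤ C

/-- `X` has a `C`-complemented subspace `G` of some dimension `h ≥ t` whose Banach-Mazur distance
to the Hilbert space `ℓ_2^h` is at most `C`. -/
def HasComplementedHilbert (X : Type) [SeminormedAddCommGroup X] [NormedSpace ℝ X]
    (C t : ℝ) : Prop :=
  ∃ (h : ℕ) (G : Submodule ℝ X), Module.finrank ℝ G = h ∧ t ≤ (h : ℝ) ∧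
    banachMazur (Euc h) G ≤ ENNReal.ofReal C ∧ IsComplemented G C

end GenericSpaces

end

/-! Let `A` be an `N × d` matrix with independent standard Gaussian entries. Its law is invariant
under rotations, so the range of `A` is a Haar distributed subspace, and it suffices to show that a
Gaussian matrix is `WellSpread` outside an event of probability at most `e^{-d}`.

With `L = log N`, two facts hold with this probability once `N` is large. By a union bound over
integer vectors, `‖A x‖_∞ ≥ (√L/4) ‖x‖` for all `x`: for a fixed unit vector the `N` coordinates of
`A x` are independent Gaussians, and `d ≤ √N` keeps the number of vectors affordable. Moreover, if
the `d` coordinates are cut into disjoint blocks of length `h` about `min(L, d)`, then on at least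
one block all `N` rows have Euclidean norm at most `10 √L`; the independence of the blocks is what
brings the failure probability down to `e^{-d}`.

On such a block `A` maps `ℓ_2^h` into `E ⊆ ℓ_∞^N` with norm at most `10 √L`, while inverting `A` on
`E` and restricting to the block has norm at most `4/√L`. The identity of `ℓ_2^h` thus factors
through `E` with constant 40 (`HasComplementedHilbert.of_factorization`), and by transposition
through `ℓ_1^N/E^⊥`. Bounded `N` costs only a larger constant. -/

noncomputable section

namespace GenericSpaces

open ProbabilityTheory Filter

/-! ### Factorizations of the Hilbert space identity, and matrices as maps -/

/-- If the identity of `ℓ_2^h` factors through `X` as `R ∘ S`, then `X` contains a complemented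
Hilbertian subspace of dimension `h`. -/
theorem HasComplementedHilbert.of_factorization {X : Type} [SeminormedAddCommGroup X]
    [NormedSpace ℝ X] {h : ℕ} (S : Euc h →ₗ[ℝ] X) (R : X →ₗ[ℝ] Euc h)
    (hRS : ∀ w, R (S w) = w) {a b C s : ℝ} (ha : 0 ≤ a) (hb : 0 ≤ b)
    (hS : ∀ w, ‖S w‖ ≤ a * ‖w‖) (hR : ∀ x, ‖R x‖ ≤ b * ‖x‖) (hC : a * b ≤ C)
    (hs : s ≤ (h : ℝ)) : HasComplementedHilbert X C s := by
  let T : Euc h ≃ₗ[ℝ] LinearMap.range S := LinearEquiv.ofLeftInverse (g := R) hRS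
  have hT : ∀ w, ‖T w‖ ≤ a * ‖w‖ := hS
  have hT' : ∀ y, ‖T.symm y‖ ≤ b * ‖y‖ := fun y => hR (y : X)
  refine ⟨h, LinearMap.range S, ?_, hs, ?_, ?_⟩
  · rw [← T.finrank_eq]
    simp
  · refine (iInf_le _ (T.toContinuousLinearEquivOfBounds a b hT hT')).trans
      (ENNReal.ofReal_le_ofReal (le_trans ?_ hC))
    refine mul_le_mul ?_ ?_ (norm_nonneg _) ha
    · exact ContinuousLinearMap.opNorm_le_bound _ ha hT
    · exact ContinuousLinearMap.opNorm_le_bound _ hb hT'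
  · have hP : ∀ x, ‖(S ∘ₗ R) x‖ ≤ (a * b) * ‖x‖ := fun x => by
      rw [LinearMap.comp_apply, mul_assoc]
      exact (hS _).trans (mul_le_mul_of_nonneg_left (hR x) ha)
    refine ⟨(S ∘ₗ R).mkContinuous (a * b) hP, ?_, ?_,
      (LinearMap.mkContinuous_norm_le _ (mul_nonneg ha hb) hP).trans hC⟩
    · ext x
      simp [hRS]
    · ext x
      constructor
      · rintro ⟨y, rfl⟩
        exact ⟨R y, rfl⟩
      · rintro ⟨w, rfl⟩
        exact ⟨S w, by simp [hRS]⟩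

/-- The linear map `ℝ^d → ℝ^N` whose matrix has the columns `A j`. -/
def frameMap {d N : ℕ} (A : Fin d → Euc N) : Euc d →ₗ[ℝ] Euc N :=
  (Fintype.linearCombination ℝ A).comp (WithLp.linearEquiv 2 ℝ (Fin d → ℝ)).toLinearMap

theorem frameMap_apply {d N : ℕ} (A : Fin d → Euc N) (x : Euc d) :
    frameMap A x = ∑ j, x j • A j := by
  simp [frameMap, Fintype.linearCombination_apply]

theorem frameMap_apply_coord {d N : ℕ} (A : Fin d → Euc N) (x : Euc d) (i : Fin N) :
    frameMap A x i = ∑ j, x j * A j i := by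
  simp [frameMap_apply]

/-- The maximum norm of a vector of `ℝ^N`. -/
def supNorm {N : ℕ} (y : Euc N) : ℝ := ‖(WithLp.ofLp y : Fin N → ℝ)‖

theorem supNorm_nonneg {N : ℕ} (y : Euc N) : 0 ≤ supNorm y := norm_nonneg _

theorem abs_le_supNorm {N : ℕ} (y : Euc N) (i : Fin N) : |y i| ≤ supNorm y :=
  norm_le_pi_norm (WithLp.ofLp y : Fin N → ℝ) i

theorem supNorm_le {N : ℕ} {y : Euc N} {r : ℝ} (hr : 0 ≤ r) (h : ∀ i, |y i| ≤ r) :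
    supNorm y ≤ r :=
  (pi_norm_le_iff_of_nonneg hr).2 h

/-- A lower bound for `max_i |⟨x, g_i⟩|`, where the `g_i` are the rows of the matrix with the
columns `A j`, and an upper bound for the projections of all rows onto `h` of the coordinates. -/
def WellSpread {d N : ℕ} (A : Fin d → Euc N) (t T : ℝ) (h : ℕ) : Prop :=
  (∀ x, t * ‖x‖ ≤ supNorm (frameMap A x)) ∧
    ∃ e : Fin h ↪ Fin d, ∀ i, ∑ r, (A (e r) i) ^ 2 ≤ T ^ 2

/-! ### Embedding of and restriction to a block of coordinates -/

section Coordinates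

variable {h d : ℕ} (e : Fin h ↪ Fin d)

/-- The isometric embedding of `ℓ_2^h` into `ℓ_2^d` along an injection of the coordinates. -/
def coordEmbed : Euc h →ₗ[ℝ] Euc d :=
  (WithLp.linearEquiv 2 ℝ (Fin d → ℝ)).symm.toLinearMap ∘ₗ
    Function.ExtendByZero.linearMap ℝ e ∘ₗ (WithLp.linearEquiv 2 ℝ (Fin h → ℝ)).toLinearMap

/-- The restriction of a vector to the coordinates in the range of an injection. -/
def coordRestrict : Euc d →ₗ[ℝ] Euc h :=
  (WithLp.linearEquiv 2 ℝ (Fin h → ℝ)).symm.toLinearMap ∘ₗ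
    LinearMap.funLeft ℝ ℝ e ∘ₗ (WithLp.linearEquiv 2 ℝ (Fin d → ℝ)).toLinearMap

theorem coordRestrict_apply (x : Euc d) (r : Fin h) : coordRestrict e x r = x (e r) := rfl

theorem coordEmbed_apply (w : Euc h) (r : Fin h) : coordEmbed e w (e r) = w r := by
  change Function.extend e (WithLp.ofLp w) 0 (e r) = w r
  exact e.injective.extend_apply _ _ _

theorem coordEmbed_apply_of_notMem (w : Euc h) {j : Fin d} (hj : ¬ ∃ r, e r = j) :
    coordEmbed e w j = 0 := by
  change Function.extend e (WithLp.ofLp w) 0 j = 0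
  rw [Function.extend_apply' _ _ _ hj]
  rfl

theorem sum_coordEmbed (w : Euc h) (f : Fin d → ℝ → ℝ) (hf : ∀ j, f j 0 = 0) :
    ∑ j, f j (coordEmbed e w j) = ∑ r, f (e r) (w r) := by
  rw [← Finset.sum_subset (Finset.subset_univ (Finset.univ.map e)), Finset.sum_map]
  · simp [coordEmbed_apply]
  · intro j _ hj
    rw [coordEmbed_apply_of_notMem e w (by simpa using hj), hf]

theorem norm_coordEmbed (w : Euc h) : ‖coordEmbed e w‖ = ‖w‖ := by
  rw [EuclideanSpace.norm_eq, EuclideanSpace.norm_eq,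
    sum_coordEmbed e w (fun _ u => ‖u‖ ^ 2) (by simp)]

theorem coordRestrict_coordEmbed (w : Euc h) : coordRestrict e (coordEmbed e w) = w := by
  ext r
  rw [coordRestrict_apply, coordEmbed_apply]

theorem norm_coordRestrict_le (x : Euc d) : ‖coordRestrict e x‖ ≤ ‖x‖ := by
  rw [EuclideanSpace.norm_eq, EuclideanSpace.norm_eq]
  refine Real.sqrt_le_sqrt ?_
  simp only [coordRestrict_apply]
  rw [← Finset.sum_map Finset.univ e (fun j => ‖x j‖ ^ 2)]
  exact Finset.sum_le_sum_of_subset_of_nonneg (Finset.subset_univ _) fun _ _ _ => by positivity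

end Coordinates

/-! ### Well spread matrices give complemented Hilbertian subspaces -/

section Deterministic

variable {d N h : ℕ} {A : Fin d → Euc N} {t T : ℝ}

theorem supNorm_frameMap_coordEmbed_le {e : Fin h ↪ Fin d} (hT : 0 ≤ T)
    (he : ∀ i, ∑ r, (A (e r) i) ^ 2 ≤ T ^ 2) (w : Euc h) :
    supNorm (frameMap A (coordEmbed e w)) ≤ T * ‖w‖ := by
  refine supNorm_le (by positivity) fun i => ?_
  rw [frameMap_apply_coord, sum_coordEmbed e w (fun j u => u * A j i) (by simp)]
  refine abs_le_of_sq_le_sq ?_ (by positivity)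
  refine (Finset.sum_mul_sq_le_sq_mul_sq _ _ _).trans ?_
  rw [mul_pow, EuclideanSpace.real_norm_sq_eq, mul_comm]
  gcongr
  exact he i

theorem frameMap_injective (ht : 0 < t) (hA : ∀ x, t * ‖x‖ ≤ supNorm (frameMap A x)) :
    Function.Injective (frameMap A) := by
  rw [← LinearMap.ker_eq_bot, LinearMap.ker_eq_bot']
  intro x hx
  have h1 := hA x
  rw [hx] at h1
  have h2 : supNorm (0 : Euc N) = 0 := by simp [supNorm]
  rw [h2] at h1
  have h3 : ‖x‖ ≤ 0 := by
    by_contra h4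
    push Not at h4
    nlinarith
  simpa using h3

/-- The factorization embeds the block and applies the matrix (norm at most `T`), then inverts the
matrix on its range and restricts to the block (norm at most `1 / t`). -/
theorem HasComplementedHilbert.linftySubspace_of_wellSpread (ht : 0 < t) (hT : 0 ≤ T)
    (hA : WellSpread A t T h) {E : Grass d N} (hE : E.1 = LinearMap.range (frameMap A))
    {C s : ℝ} (hC : T / t ≤ C) (hs : s ≤ (h : ℝ)) :
    HasComplementedHilbert (linftySubspace E) C s := by
  obtain ⟨hlow, e, he⟩ := hA
  let F : Euc d →ₗ[ℝ] linftySubspace E :=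
    ((WithLp.linearEquiv 2 ℝ (Fin N → ℝ)).toLinearMap ∘ₗ frameMap A).codRestrict _ (by
      intro x
      exact ⟨frameMap A x, by rw [SetLike.mem_coe, hE]; exact ⟨x, rfl⟩, rfl⟩)
  have hF : ∀ x, ‖F x‖ = supNorm (frameMap A x) := fun x => rfl
  have hinj : Function.Injective F := by
    intro x y hxy
    refine frameMap_injective ht hlow ?_
    exact (WithLp.linearEquiv 2 ℝ (Fin N → ℝ)).injective (congrArg Subtype.val hxy)
  have hsurj : Function.Surjective F := by
    rintro ⟨y, z, hz, rfl⟩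
    rw [SetLike.mem_coe, hE] at hz
    obtain ⟨x, rfl⟩ := hz
    exact ⟨x, rfl⟩
  let F' := LinearEquiv.ofBijective F ⟨hinj, hsurj⟩
  refine HasComplementedHilbert.of_factorization (F ∘ₗ coordEmbed e)
    (coordRestrict e ∘ₗ F'.symm.toLinearMap) (a := T) (b := t⁻¹) ?_ hT (by positivity) ?_ ?_
    (by rwa [← div_eq_mul_inv]) hs
  · intro w
    have : F'.symm (F (coordEmbed e w)) = coordEmbed e w := F'.symm_apply_apply _
    simp [this, coordRestrict_coordEmbed]
  · intro w
    exact supNorm_frameMap_coordEmbed_le hT he w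
  · intro y
    obtain ⟨x, rfl⟩ := hsurj y
    have : F'.symm (F x) = x := F'.symm_apply_apply _
    simp only [LinearMap.comp_apply, LinearEquiv.coe_coe, this, hF]
    refine (norm_coordRestrict_le e x).trans ?_
    rw [← div_eq_inv_mul, le_div_iff₀' ht]
    exact hlow x

/-- The transpose of `frameMap A`, as a map from `ℓ_1^N`. -/
def frameAdjoint (A : Fin d → Euc N) : PiLp 1 (fun _ : Fin N => ℝ) →ₗ[ℝ] Euc d where
  toFun y := WithLp.toLp 2 fun j => ∑ i, y i * A j i
  map_add' y z := by
    ext j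
    simp [add_mul, Finset.sum_add_distrib]
  map_smul' a y := by
    ext j
    simp [Finset.mul_sum, mul_assoc]

theorem frameAdjoint_apply (y : PiLp 1 (fun _ : Fin N => ℝ)) (j : Fin d) :
    frameAdjoint A y j = ∑ i, y i * A j i := rfl

/-- By the Hahn-Banach theorem, a lower bound for `frameMap A` in the maximum norm gives preimages
of small `ℓ_1` norm under the transpose. -/
theorem exists_frameAdjoint_eq (ht : 0 < t) (hA : ∀ x, t * ‖x‖ ≤ supNorm (frameMap A x))
    (w : Euc d) : ∃ y, frameAdjoint A y = w ∧ ‖y‖ ≤ t⁻¹ * ‖w‖ := by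
  let F : Euc d →ₗ[ℝ] (Fin N → ℝ) :=
    (WithLp.linearEquiv 2 ℝ (Fin N → ℝ)).toLinearMap ∘ₗ frameMap A
  have hinj : Function.Injective F :=
    (WithLp.linearEquiv 2 ℝ (Fin N → ℝ)).injective.comp (frameMap_injective ht hA)
  let F' : Euc d ≃ₗ[ℝ] LinearMap.range F := LinearEquiv.ofInjective F hinj
  have hF' : ∀ z, ‖F'.symm z‖ ≤ t⁻¹ * ‖z‖ := by
    intro z
    obtain ⟨x, rfl⟩ := F'.surjective z
    rw [F'.symm_apply_apply, ← div_eq_inv_mul, le_div_iff₀' ht]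
    exact hA x
  have hbound : ∀ z, ‖((innerSL ℝ w).toLinearMap ∘ₗ F'.symm.toLinearMap) z‖
      ≤ (t⁻¹ * ‖w‖) * ‖z‖ := by
    intro z
    refine (norm_inner_le_norm w (F'.symm z)).trans ?_
    rw [mul_comm t⁻¹, mul_assoc]
    exact mul_le_mul_of_nonneg_left (hF' z) (norm_nonneg _)
  let φ : StrongDual ℝ (LinearMap.range F) :=
    ((innerSL ℝ w).toLinearMap ∘ₗ F'.symm.toLinearMap).mkContinuous _ hbound
  have hφ : ‖φ‖ ≤ t⁻¹ * ‖w‖ := LinearMap.mkContinuous_norm_le _ (by positivity) hbound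
  obtain ⟨g, hg, hgn⟩ := exists_extension_norm_eq (LinearMap.range F) φ
  have hgsum : ∀ v : Fin N → ℝ, g v = ∑ i, v i * g (Pi.single i 1) := by
    intro v
    conv_lhs => rw [pi_eq_sum_univ' v]
    simp [map_sum, Pi.single]
  refine ⟨WithLp.toLp 1 fun i => g (Pi.single i 1), ?_, ?_⟩
  · ext j
    have h1 : g (F (EuclideanSpace.single j 1)) = w j := by
      have h2 := hg (F' (EuclideanSpace.single j 1))
      have h3 : ((F' (EuclideanSpace.single j 1) : LinearMap.range F) : Fin N → ℝ)
        = F (EuclideanSpace.single j 1) := rfl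
      rw [← h3, h2]
      change inner ℝ w (F'.symm (F' (EuclideanSpace.single j 1))) = w j
      rw [F'.symm_apply_apply]
      simp [EuclideanSpace.inner_single_right]
    rw [frameAdjoint_apply, ← h1, hgsum]
    refine Finset.sum_congr rfl fun i _ => ?_
    have h4 : F (EuclideanSpace.single j 1) i = A j i := by
      change frameMap A (EuclideanSpace.single j 1) i = A j i
      rw [frameMap_apply_coord]
      simp
    rw [h4]
    simp [mul_comm]
  · rw [PiLp.norm_eq_of_L1]
    -- Testing `g` on the sign vector of its coefficients yields their `ℓ_1` norm.
    have h1 := g.le_opNorm fun i => ((SignType.sign (g (Pi.single i 1)) : SignType) : ℝ)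
    rw [hgsum] at h1
    have h2 : ‖fun i => ((SignType.sign (g (Pi.single i 1)) : SignType) : ℝ)‖ ≤ 1 := by
      refine (pi_norm_le_iff_of_nonneg zero_le_one).2 fun i => ?_
      rcases lt_trichotomy (g (Pi.single i 1)) 0 with h | h | h <;> simp [h]
    simp only [sign_mul_self, Real.norm_eq_abs] at h1 ⊢
    rw [abs_of_nonneg (Finset.sum_nonneg fun i _ => abs_nonneg _)] at h1
    refine h1.trans ((mul_le_of_le_one_right (norm_nonneg g) h2).trans ?_)
    rw [hgn]
    exact hφ

/-- This lets the transpose identify `ℓ_1^N / E^⊥` with `ℝ^d`. -/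
theorem ker_frameAdjoint {E : Grass d N} (hE : E.1 = LinearMap.range (frameMap A)) :
    LinearMap.ker (frameAdjoint A) = perpInLOne E := by
  have key : ∀ (v : Euc N) (x : Euc d), inner ℝ (frameMap A x) v
      = ∑ j, x j * ∑ i, v i * A j i := by
    intro v x
    simp only [PiLp.inner_apply, frameMap_apply_coord, Finset.mul_sum]
    rw [Finset.sum_comm]
    refine Finset.sum_congr rfl fun i _ => ?_
    simp [Finset.mul_sum]
    refine Finset.sum_congr rfl fun j _ => ?_
    ring
  have hperp : ∀ v : Euc N, v ∈ E.1ᗮ ↔ ∀ j, ∑ i, v i * A j i = 0 := by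
    intro v
    rw [hE, Submodule.mem_orthogonal]
    constructor
    · intro hv j
      have := hv _ ⟨EuclideanSpace.single j 1, rfl⟩
      rw [key] at this
      simpa using this
    · rintro hv _ ⟨x, rfl⟩
      rw [key]
      simp [hv]
  ext y
  rw [LinearMap.mem_ker]
  constructor
  · intro hy
    refine ⟨WithLp.toLp 2 (WithLp.ofLp y), (hperp _).2 fun j => ?_, rfl⟩
    have := congrArg (fun z : Euc d => z j) hy
    exact this
  · rintro ⟨v, hv, rfl⟩
    ext j
    exact (hperp v).1 hv j

/-- By the triangle inequality an operator on `ℓ_1^N` is controlled by the images of the unit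
vectors, here the rows restricted to the block. -/
theorem norm_coordRestrict_frameAdjoint_le {e : Fin h ↪ Fin d} (hT : 0 ≤ T)
    (he : ∀ i, ∑ r, (A (e r) i) ^ 2 ≤ T ^ 2) (y : PiLp 1 (fun _ : Fin N => ℝ)) :
    ‖coordRestrict e (frameAdjoint A y)‖ ≤ T * ‖y‖ := by
  have h1 : coordRestrict e (frameAdjoint A y)
      = ∑ i, y i • (WithLp.toLp 2 fun r => A (e r) i : Euc h) := by
    ext r
    simp [coordRestrict_apply, frameAdjoint_apply]
  rw [h1, PiLp.norm_eq_of_L1, Finset.mul_sum]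
  refine (norm_sum_le _ _).trans (Finset.sum_le_sum fun i _ => ?_)
  rw [norm_smul, mul_comm]
  refine mul_le_mul_of_nonneg_right ?_ (norm_nonneg _)
  refine le_of_sq_le_sq ?_ hT
  rw [EuclideanSpace.real_norm_sq_eq]
  exact he i

/-- The transposed factorization: the embedding now has norm at most `1 / t`, by Hahn-Banach, and
the map back has norm at most `T`. -/
theorem HasComplementedHilbert.lOneQuotient_of_wellSpread (ht : 0 < t) (hT : 0 ≤ T)
    (hA : WellSpread A t T h) {E : Grass d N} (hE : E.1 = LinearMap.range (frameMap A))
    {C s : ℝ} (hC : T / t ≤ C) (hs : s ≤ (h : ℝ)) :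
    HasComplementedHilbert (LOneQuotient E) C s := by
  obtain ⟨hlow, e, he⟩ := hA
  have hker := ker_frameAdjoint hE
  let F : LOneQuotient E →ₗ[ℝ] Euc d := (perpInLOne E).liftQ (frameAdjoint A) hker.ge
  have hF : ∀ y, F (Submodule.Quotient.mk y) = frameAdjoint A y := fun y => rfl
  have hinj : Function.Injective F := by
    rw [← LinearMap.ker_eq_bot]
    exact Submodule.ker_liftQ_eq_bot _ _ _ hker.le
  have hsurj : Function.Surjective F := fun w => by
    obtain ⟨y, hy, -⟩ := exists_frameAdjoint_eq ht hlow w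
    exact ⟨Submodule.Quotient.mk y, hy⟩
  let F' := LinearEquiv.ofBijective F ⟨hinj, hsurj⟩
  refine HasComplementedHilbert.of_factorization (F'.symm.toLinearMap ∘ₗ coordEmbed e)
    (coordRestrict e ∘ₗ F) (a := t⁻¹) (b := T) ?_ (by positivity) hT ?_ ?_
    (by rwa [← div_eq_inv_mul]) hs
  · intro w
    have : F (F'.symm (coordEmbed e w)) = coordEmbed e w := F'.apply_symm_apply _
    simp [this, coordRestrict_coordEmbed]
  · intro w
    obtain ⟨y, hy, hyn⟩ := exists_frameAdjoint_eq ht hlow (coordEmbed e w)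
    have h1 : F'.symm (coordEmbed e w) = Submodule.Quotient.mk y := by
      rw [LinearEquiv.symm_apply_eq]
      exact hy.symm
    rw [LinearMap.comp_apply, LinearEquiv.coe_coe, h1]
    rw [norm_coordEmbed] at hyn
    exact (Submodule.Quotient.norm_mk_le _ _).trans hyn
  · intro x
    refine le_of_forall_pos_le_add fun δ hδ => ?_
    -- The quotient norm is an infimum, so a nearly optimal representative is used; `T + 1` keeps
    -- the denominator positive when `T = 0`.
    obtain ⟨m, rfl, hm⟩ := Submodule.Quotient.norm_mk_lt x (ε := δ / (T + 1)) (by positivity)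
    rw [LinearMap.comp_apply, hF]
    refine (norm_coordRestrict_frameAdjoint_le hT he m).trans ?_
    refine (mul_le_mul_of_nonneg_left hm.le hT).trans ?_
    rw [mul_add]
    gcongr
    rw [mul_div_assoc', div_le_iff₀ (by positivity)]
    nlinarith

end Deterministic

/-! ### Transfer from Gaussian matrices to the Grassmann manifold -/

instance (N : ℕ) : (orthHaar N).IsHaarMeasure :=
  inferInstanceAs (Measure.haarMeasure _).IsHaarMeasure

instance (N : ℕ) : SecondCountableTopology (OrthGroup N) :=
  TopologicalSpace.Subtype.secondCountableTopology _

/-- A right translate is again left invariant, hence a multiple of the Haar measure, and comparing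
total masses shows that the factor is 1. -/
instance (N : ℕ) : (orthHaar N).IsMulRightInvariant where
  map_mul_right_eq_self g := by
    have hp : IsProbabilityMeasure (Measure.map (· * g) (orthHaar N)) :=
      Measure.isProbabilityMeasure_map (continuous_mul_const g).measurable.aemeasurable
    have h := Measure.isMulInvariant_eq_smul_of_compactSpace
      (Measure.map (· * g) (orthHaar N)) (orthHaar N)
    have h1 := congrArg (fun μ : Measure (OrthGroup N) => μ Set.univ) h
    simp only [measure_univ, Measure.smul_apply, ENNReal.smul_def, smul_eq_mul, mul_one] at h1
    rw [h]
    ext s _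
    simp [ENNReal.smul_def, ← h1]

/-- The action of an orthogonal map on the columns of a matrix. -/
def rotateFrame {d N : ℕ} (U : OrthGroup N) (A : Fin d → Euc N) : Fin d → Euc N :=
  fun j => (U : Euc N →L[ℝ] Euc N) (A j)

theorem continuous_rotateFrame (d N : ℕ) :
    Continuous fun p : OrthGroup N × (Fin d → Euc N) => rotateFrame p.1 p.2 := by
  unfold rotateFrame
  fun_prop

theorem frameMap_rotateFrame {d N : ℕ} (U : OrthGroup N) (A : Fin d → Euc N) (x : Euc d) :
    frameMap (rotateFrame U A) x = (U : Euc N →L[ℝ] Euc N) (frameMap A x) := by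
  simp [frameMap_apply, rotateFrame]

/-- The law of an `N × d` matrix with independent standard Gaussian entries. -/
def gaussFrame (d N : ℕ) : Measure (Fin d → Euc N) :=
  Measure.pi fun _ => stdGaussian (Euc N)

instance (d N : ℕ) : IsProbabilityMeasure (gaussFrame d N) := by
  unfold gaussFrame
  infer_instance

theorem map_rotateFrame_gaussFrame {d N : ℕ} (U : OrthGroup N) :
    (gaussFrame d N).map (rotateFrame U) = gaussFrame d N := by
  have h : (stdGaussian (Euc N)).map (U : Euc N →L[ℝ] Euc N) = stdGaussian (Euc N) :=
    stdGaussian_map (Unitary.linearIsometryEquiv U)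
  have hi : ∀ i : Fin d, SigmaFinite ((stdGaussian (Euc N)).map (U : Euc N →L[ℝ] Euc N)) := by
    intro i
    rw [h]
    infer_instance
  refine (Measure.pi_map_pi (f := fun _ => (U : Euc N →L[ℝ] Euc N)) (hμ := hi)
    fun i => (ContinuousLinearMap.continuous _).measurable.aemeasurable).trans ?_
  simp only [h]
  rfl

/-- The orthogonal group acts transitively on the Grassmann manifold. -/
theorem exists_rotate_eq {d N : ℕ} (E F : Grass d N) : ∃ U, rotate U E = F := by
  let e : E.1 ≃ₗᵢ[ℝ] F.1 := (stdOrthonormalBasis ℝ E.1).equiv (stdOrthonormalBasis ℝ F.1)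
    (finCongr (E.2.trans F.2.symm))
  let L : Euc N →ₗᵢ[ℝ] Euc N := (F.1.subtypeₗᵢ.comp e.toLinearIsometry).extend
  let L' : Euc N ≃ₗᵢ[ℝ] Euc N := L.toLinearIsometryEquiv rfl
  refine ⟨Unitary.linearIsometryEquiv.symm L', ?_⟩
  have hL : ∀ x : E.1, L' (x : Euc N) = e x := fun x =>
    LinearIsometry.extend_apply (F.1.subtypeₗᵢ.comp e.toLinearIsometry) x
  apply Subtype.ext
  change E.1.map _ = F.1
  rw [MulEquiv.apply_symm_apply]
  refine Submodule.eq_of_le_of_finrank_eq ?_ ?_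
  · rintro _ ⟨x, hx, rfl⟩
    change L' x ∈ F.1
    rw [hL ⟨x, hx⟩]
    exact (e ⟨x, hx⟩).2
  · exact (LinearEquiv.finrank_map_eq L'.toLinearEquiv _).trans (E.2.trans F.2.symm)

theorem range_frameMap_rotateFrame {d N : ℕ} (U : OrthGroup N) {A : Fin d → Euc N}
    {E : Grass d N} (hE : E.1 = LinearMap.range (frameMap A)) :
    (rotate U E).1 = LinearMap.range (frameMap (rotateFrame U A)) := by
  change E.1.map _ = _
  rw [hE, ← LinearMap.range_comp]
  congr 1
  ext x : 1
  exact (frameMap_rotateFrame U A x).symm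

theorem rotate_mul {d N : ℕ} (U V : OrthGroup N) (E : Grass d N) :
    rotate (U * V) E = rotate U (rotate V E) := by
  apply Subtype.ext
  change E.1.map _ = (E.1.map _).map _
  rw [← Submodule.map_comp]
  congr 1

/-- The range of a Gaussian matrix is a random subspace distributed according to `grassHaar`; only
the resulting lower bound for the measure of a set of subspaces is stated. -/
theorem one_sub_le_grassHaar {d N : ℕ} (hdN : d ≤ N) {M : Set (Fin d → Euc N)} (hM : IsOpen M)
    (hlt : gaussFrame d N M < 1) (hinj : ∀ A ∉ M, Function.Injective (frameMap A))
    {S : Set (Grass d N)}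
    (hS : ∀ A ∉ M, ∀ E : Grass d N, E.1 = LinearMap.range (frameMap A) → E ∈ S) :
    1 - gaussFrame d N M ≤ grassHaar hdN S := by
  have hopen : IsOpen {p : OrthGroup N × (Fin d → Euc N) | rotateFrame p.1 p.2 ∈ M} :=
    hM.preimage (continuous_rotateFrame d N)
  have hfub : ∫⁻ A, orthHaar N {U | rotateFrame U A ∈ M} ∂gaussFrame d N
      = gaussFrame d N M := by
    have h1 := Measure.prod_apply (μ := orthHaar N) (ν := gaussFrame d N) hopen.measurableSet
    have h2 := Measure.prod_apply_symm (μ := orthHaar N) (ν := gaussFrame d N)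
      hopen.measurableSet
    rw [h1] at h2
    refine h2.symm.trans ?_
    have h3 : ∀ U : OrthGroup N, gaussFrame d N (Prod.mk U ⁻¹'
        {p : OrthGroup N × (Fin d → Euc N) | rotateFrame p.1 p.2 ∈ M}) = gaussFrame d N M := by
      intro U
      conv_rhs => rw [← map_rotateFrame_gaussFrame U]
      rw [Measure.map_apply ?_ hM.measurableSet]
      · rfl
      · exact ((continuous_rotateFrame d N).comp (Continuous.prodMk_right U)).measurable
    simp only [h3, lintegral_const, measure_univ, mul_one]
  -- By Fubini the probability that `U A ∈ M`, averaged over `A`, is the Gaussian measure of `M`;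
  -- some fixed `A` does no worse than this average.
  obtain ⟨A, hA⟩ := exists_le_lintegral (μ := gaussFrame d N)
    (f := fun A => orthHaar N {U | rotateFrame U A ∈ M})
    (measurable_measure_prodMk_right hopen.measurableSet).aemeasurable
  rw [hfub] at hA
  have hAopen : IsOpen {U | rotateFrame U A ∈ M} :=
    hM.preimage ((continuous_rotateFrame d N).comp (Continuous.prodMk_left A))
  obtain ⟨U₀, hU₀⟩ : ∃ U, rotateFrame U A ∉ M := by
    by_contra! hall
    have : {U : OrthGroup N | rotateFrame U A ∈ M} = Set.univ := Set.eq_univ_of_forall hall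
    rw [this, measure_univ] at hA
    exact absurd (hA.trans_lt hlt) (lt_irrefl _)
  have hAinj : Function.Injective (frameMap A) := fun x y hxy => hinj _ hU₀ (by
    rw [frameMap_rotateFrame, frameMap_rotateFrame, hxy])
  let E : Grass d N := ⟨LinearMap.range (frameMap A), by
    rw [LinearMap.finrank_range_of_inj hAinj]
    simp⟩
  -- Right invariance allows the coordinate subspace to be replaced by the range of this fixed `A`.
  obtain ⟨V, hV⟩ := exists_rotate_eq (coordSubspace hdN) E
  calc 1 - gaussFrame d N M ≤ 1 - orthHaar N {U | rotateFrame U A ∈ M} :=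
        tsub_le_tsub_left hA 1
    _ = orthHaar N {U | rotateFrame U A ∈ M}ᶜ :=
        (prob_compl_eq_one_sub hAopen.measurableSet).symm
    _ ≤ orthHaar N ((fun U => U * V) ⁻¹' {U | rotate U (coordSubspace hdN) ∈ S}) := by
        refine measure_mono fun U hU => ?_
        rw [Set.mem_preimage, Set.mem_ofPred_eq, rotate_mul, hV]
        exact hS _ hU _ (range_frameMap_rotateFrame U rfl)
    _ = orthHaar N {U | rotate U (coordSubspace hdN) ∈ S} := measure_preimage_mul_right _ _ _
    _ ≤ grassHaar hdN S :=
        Measure.le_map_apply (continuous_rotate _).measurable.aemeasurable _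

/-! ### Gaussian estimates -/

theorem integrable_exp_sq_gaussianReal :
    Integrable (fun x : ℝ => Real.exp (x ^ 2 / 4)) (gaussianReal 0 1) := by
  rw [gaussianReal_of_var_ne_zero _ one_ne_zero,
    integrable_withDensity_iff_integrable_smul' (measurable_gaussianPDF 0 1)
      (ae_of_all _ fun _ => gaussianPDF_lt_top)]
  have h := (integrable_exp_neg_mul_sq (b := 1 / 4) (by norm_num)).const_mul
    (√(2 * Real.pi))⁻¹
  refine h.congr (ae_of_all _ fun x => ?_)
  simp only [toReal_gaussianPDF, gaussianPDFReal_def, smul_eq_mul, NNReal.coe_one, mul_one,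
    sub_zero]
  rw [mul_assoc, ← Real.exp_add]
  congr 2
  ring

/-- Since `√2 ≤ e`, each squared entry costs at most a factor `e` in the Chernoff bound below. -/
theorem integral_exp_sq_gaussianReal :
    ∫ x : ℝ, Real.exp (x ^ 2 / 4) ∂(gaussianReal 0 1) = √2 := by
  rw [integral_gaussianReal_eq_integral_smul one_ne_zero]
  have h : ∀ x : ℝ, gaussianPDFReal 0 1 x • Real.exp (x ^ 2 / 4)
      = (√(2 * Real.pi))⁻¹ * Real.exp (-(1 / 4) * x ^ 2) := by
    intro x
    simp only [gaussianPDFReal_def, smul_eq_mul, NNReal.coe_one, mul_one, sub_zero]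
    rw [mul_assoc, ← Real.exp_add]
    congr 2
    ring
  simp only [h]
  rw [integral_const_mul, integral_gaussian, ← Real.sqrt_inv, ← Real.sqrt_mul (by positivity)]
  congr 1
  have := Real.pi_ne_zero
  field_simp
  norm_num

theorem gaussianReal_Ioo_le (t : ℝ) :
    (gaussianReal 0 1).real (Set.Ioo (-t) t) ≤ 1 - Real.exp (-t ^ 2) / 9 := by
  have hd : Disjoint (Set.Ioo (-t) t) (Set.Icc t (t + 1)) := by
    rw [Set.disjoint_left]
    intro x hx hx'
    exact absurd hx.2 (not_lt.2 hx'.1)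
  have hsum : (gaussianReal 0 1).real (Set.Ioo (-t) t)
      + (gaussianReal 0 1).real (Set.Icc t (t + 1)) ≤ 1 := by
    rw [← measureReal_union hd measurableSet_Icc]
    exact measureReal_le_one
  suffices h : Real.exp (-t ^ 2) / 9 ≤ (gaussianReal 0 1).real (Set.Icc t (t + 1)) by linarith
  have hpi : √(2 * Real.pi) ≤ 3 := by
    rw [Real.sqrt_le_left (by norm_num)]
    nlinarith [Real.pi_lt_four]
  have hpdf : ∀ x ∈ Set.Icc t (t + 1), Real.exp (-t ^ 2) / 9 ≤ gaussianPDFReal 0 1 x := by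
    intro x hx
    simp only [gaussianPDFReal_def, NNReal.coe_one, mul_one, sub_zero]
    have h1 : Real.exp (-t ^ 2) * Real.exp (-1) ≤ Real.exp (-x ^ 2 / 2) := by
      rw [← Real.exp_add, Real.exp_le_exp]
      -- At the endpoint `t + 1` this is `(t + 1)^2 / 2 ≤ t^2 + 1`, that is `(t - 1)^2 ≥ 0`.
      nlinarith [hx.1, hx.2, sq_nonneg (t - 1)]
    have h2 : (1 : ℝ) / 3 ≤ (√(2 * Real.pi))⁻¹ := by
      rw [one_div]
      exact inv_anti₀ (by positivity) hpi
    have h3 : (1 : ℝ) / 3 ≤ Real.exp (-1) := by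
      rw [Real.exp_neg, one_div]
      exact inv_anti₀ (Real.exp_pos _) (by linarith [Real.exp_one_lt_d9])
    calc Real.exp (-t ^ 2) / 9 = 1 / 3 * (Real.exp (-t ^ 2) * (1 / 3)) := by ring
      _ ≤ (√(2 * Real.pi))⁻¹ * (Real.exp (-t ^ 2) * Real.exp (-1)) := by gcongr
      _ ≤ _ := by gcongr
  rw [measureReal_def, gaussianReal_apply_eq_integral 0 one_ne_zero,
    ENNReal.toReal_ofReal (integral_nonneg fun x => gaussianPDFReal_nonneg 0 1 x)]
  have h4 := setIntegral_mono_on (μ := volume) (s := Set.Icc t (t + 1))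
    (f := fun _ => Real.exp (-t ^ 2) / 9) (g := gaussianPDFReal 0 1)
    (by simp) (integrable_gaussianPDFReal 0 1).integrableOn measurableSet_Icc hpdf
  simpa using h4

/-- The exponential moments of sums of squares of entries of a Gaussian matrix. -/
theorem measureReal_sum_sq_le {d N : ℕ} (S : Fin d → Finset (Fin N)) (u : ℝ) :
    (gaussFrame d N).real {A | u ≤ ∑ j, ∑ i ∈ S j, (A j i) ^ 2}
      ≤ Real.exp ((∑ j, ((S j).card : ℝ)) - u / 4) := by
  classical
  -- The factor 1 off `S j` turns the exponential into a product over all entries, which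
  -- independence then splits.
  let g : Fin d → Fin N → ℝ → ℝ := fun j i x => if i ∈ S j then Real.exp (x ^ 2 / 4) else 1
  have hgi : ∀ j i, Integrable (g j i) (gaussianReal 0 1) := by
    intro j i
    by_cases h : i ∈ S j
    · simpa [g, h] using integrable_exp_sq_gaussianReal
    · simp [g, h]
  have hgI : ∀ j i, ∫ x, g j i x ∂(gaussianReal 0 1) ≤ Real.exp (if i ∈ S j then 1 else 0) := by
    intro j i
    by_cases h : i ∈ S j
    · simp only [g, h, if_true, integral_exp_sq_gaussianReal]
      refine le_trans ?_ (by linarith [Real.exp_one_gt_d9] : (2 : ℝ) ≤ Real.exp 1)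
      rw [Real.sqrt_le_left (by norm_num)]
      norm_num
    · simp [g, h]
  have hg0 : ∀ j i x, 0 ≤ g j i x := by
    intro j i x
    by_cases h : i ∈ S j
    · simp [g, h, Real.exp_nonneg]
    · simp [g, h]
  have hcol : ∀ j, Integrable (fun y : Euc N => ∏ i, g j i (y i)) (stdGaussian (Euc N)) := by
    intro j
    rw [← map_pi_eq_stdGaussian]
    exact (MeasurableEmbedding.integrable_map_iff
      (MeasurableEquiv.toLp 2 (Fin N → ℝ)).measurableEmbedding).2 (Integrable.fintype_prod (hgi j))
  have hcolI : ∀ j, ∫ y : Euc N, ∏ i, g j i (y i) ∂(stdGaussian (Euc N))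
      ≤ Real.exp ((S j).card : ℝ) := by
    intro j
    rw [← map_pi_eq_stdGaussian]
    refine ((MeasurableEquiv.toLp 2 (Fin N → ℝ)).measurableEmbedding.integral_map
      (fun y : Euc N => ∏ i, g j i (y i))).trans_le ?_
    refine (integral_fintype_prod_eq_prod (g j)).trans_le ?_
    refine (Finset.prod_le_prod (fun i _ => integral_nonneg (hg0 j i)) fun i _ =>
      hgI j i).trans ?_
    rw [← Real.exp_sum]
    simp
  have hexp : ∀ A : Fin d → Euc N, ∏ j, ∏ i, g j i (A j i)
      = Real.exp ((∑ j, ∑ i ∈ S j, (A j i) ^ 2) / 4) := by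
    intro A
    rw [Finset.sum_div, Real.exp_sum]
    refine Finset.prod_congr rfl fun j _ => ?_
    rw [Finset.sum_div, Real.exp_sum, Finset.prod_ite_mem, Finset.univ_inter]
  have hint : Integrable (fun A : Fin d → Euc N => ∏ j, ∏ i, g j i (A j i)) (gaussFrame d N) :=
    Integrable.fintype_prod hcol
  have hI : ∫ A : Fin d → Euc N, ∏ j, ∏ i, g j i (A j i) ∂(gaussFrame d N)
      ≤ Real.exp (∑ j, ((S j).card : ℝ)) := by
    rw [gaussFrame, integral_fintype_prod_eq_prod (fun j (y : Euc N) => ∏ i, g j i (y i)),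
      Real.exp_sum]
    exact Finset.prod_le_prod (fun j _ => integral_nonneg fun y =>
      Finset.prod_nonneg fun i _ => hg0 j i _) fun j _ => hcolI j
  have hmarkov := mul_meas_ge_le_integral_of_nonneg (ae_of_all _ fun A : Fin d → Euc N =>
    Finset.prod_nonneg fun j _ => Finset.prod_nonneg fun i _ => hg0 j i (A j i)) hint
    (Real.exp (u / 4))
  have hset : {A : Fin d → Euc N | Real.exp (u / 4) ≤ ∏ j, ∏ i, g j i (A j i)}
      = {A | u ≤ ∑ j, ∑ i ∈ S j, (A j i) ^ 2} := by
    ext A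
    rw [Set.mem_ofPred_eq, Set.mem_ofPred_eq, hexp, Real.exp_le_exp]
    constructor <;> intro h <;> linarith
  rw [hset] at hmarkov
  rw [Real.exp_sub, le_div_iff₀ (Real.exp_pos _), mul_comm]
  exact hmarkov.trans hI

/-- The image of a fixed vector under a Gaussian matrix is a Gaussian vector. -/
theorem map_frameMap_gaussFrame {d N : ℕ} (z : Euc d) :
    (gaussFrame d N).map (fun A => frameMap A z)
      = (stdGaussian (Euc N)).map fun y => ‖z‖ • y := by
  have hm : ∀ j, Measurable fun y : Euc N => z j • y := fun j => measurable_const_smul _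
  have hp : ∀ j, IsProbabilityMeasure ((stdGaussian (Euc N)).map fun y => z j • y) :=
    fun j => Measure.isProbabilityMeasure_map (hm j).aemeasurable
  have h1 : (gaussFrame d N).map (fun A => frameMap A z)
      = (Measure.pi fun j => (stdGaussian (Euc N)).map fun y => z j • y).map
        fun A => ∑ j, A j := by
    rw [← Measure.pi_map_pi fun j => (hm j).aemeasurable, Measure.map_map (by fun_prop)
      (by fun_prop)]
    congr 1
  have hq : IsProbabilityMeasure ((gaussFrame d N).map (fun A => frameMap A z)) := by
    rw [h1]
    exact Measure.isProbabilityMeasure_map (Measurable.aemeasurable (by fun_prop))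
  have hq' : IsProbabilityMeasure ((stdGaussian (Euc N)).map fun y => ‖z‖ • y) :=
    Measure.isProbabilityMeasure_map (measurable_const_smul _).aemeasurable
  refine Measure.ext_of_charFun ?_
  rw [h1, charFun_map_sum_pi_eq_prod]
  ext s
  simp only [Finset.prod_apply, charFun_map_smul, charFun_stdGaussian, ← Complex.exp_sum]
  have h2 : ∑ j, -‖z j • s‖ ^ 2 / 2 = -‖‖z‖ • s‖ ^ 2 / 2 := by
    simp only [norm_smul, norm_norm, mul_pow, EuclideanSpace.norm_sq_eq z]
    rw [← Finset.sum_div, Finset.sum_neg_distrib, Finset.sum_mul]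
  exact congrArg Complex.exp (by exact_mod_cast h2)

theorem measurableSet_supNorm_lt {N : ℕ} (t : ℝ) : MeasurableSet {y : Euc N | supNorm y < t} := by
  have : Continuous fun y : Euc N => supNorm y :=
    continuous_norm.comp (PiLp.continuous_ofLp 2 _)
  exact (isOpen_lt this continuous_const).measurableSet

/-- All `N` independent coordinates would have to lie in `(-t, t)` after division by `‖z‖`; then `1
- s ≤ e^{-s}`. -/
theorem measureReal_supNorm_frameMap_lt_le {d N : ℕ} {z : Euc d} (hz : z ≠ 0) {t : ℝ}
    (ht : 0 < t) :
    (gaussFrame d N).real {A | supNorm (frameMap A z) < t * ‖z‖}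
      ≤ Real.exp (-(N * (Real.exp (-t ^ 2) / 9))) := by
  have hz' : 0 < ‖z‖ := norm_pos_iff.2 hz
  have hcont : Continuous fun A : Fin d → Euc N => frameMap A z := by
    simp only [frameMap_apply]
    fun_prop
  have h1 : (gaussFrame d N) {A | supNorm (frameMap A z) < t * ‖z‖}
      = (gaussianReal 0 1 (Set.Ioo (-t) t)) ^ N := by
    have h2 := congrArg (fun μ : Measure (Euc N) => μ {y | supNorm y < t * ‖z‖})
      (map_frameMap_gaussFrame (N := N) z)
    simp only [Measure.map_apply hcont.measurable (measurableSet_supNorm_lt _),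
      Measure.map_apply (measurable_const_smul ‖z‖) (measurableSet_supNorm_lt _)] at h2
    refine h2.trans ?_
    rw [← map_pi_eq_stdGaussian, Measure.map_apply (by fun_prop)
      (measurable_const_smul ‖z‖ (measurableSet_supNorm_lt _))]
    have h3 : WithLp.toLp 2 ⁻¹' ((fun y : Euc N => ‖z‖ • y) ⁻¹' {y | supNorm y < t * ‖z‖})
        = Set.univ.pi fun _ : Fin N => Set.Ioo (-t) t := by
      ext v
      have h4 : supNorm (‖z‖ • (WithLp.toLp 2 v : Euc N)) = ‖z‖ * ‖v‖ := by
        change ‖‖z‖ • v‖ = _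
        rw [norm_smul, norm_norm]
      simp only [Set.mem_preimage, Set.mem_ofPred_eq, h4, Set.mem_univ_pi, Set.mem_Ioo, ← abs_lt]
      rw [mul_comm, mul_lt_mul_iff_left₀ hz', pi_norm_lt_iff ht]
      rfl
    rw [h3, Measure.pi_pi]
    simp
  rw [measureReal_def, h1, ENNReal.toReal_pow, ← measureReal_def]
  calc (gaussianReal 0 1).real (Set.Ioo (-t) t) ^ N
      ≤ (Real.exp (-(Real.exp (-t ^ 2) / 9))) ^ N := by
        refine pow_le_pow_left₀ measureReal_nonneg ?_ N
        refine (gaussianReal_Ioo_le t).trans ?_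
        linarith [Real.add_one_le_exp (-(Real.exp (-t ^ 2) / 9))]
    _ = _ := by
        rw [← Real.exp_nat_mul]
        congr 1
        ring

/-! ### From integer vectors to all vectors -/

theorem supNorm_add_le {N : ℕ} (y z : Euc N) : supNorm (y + z) ≤ supNorm y + supNorm z :=
  norm_add_le (WithLp.ofLp y : Fin N → ℝ) (WithLp.ofLp z)

theorem supNorm_smul {N : ℕ} (a : ℝ) (y : Euc N) : supNorm (a • y) = |a| * supNorm y :=
  norm_smul a (WithLp.ofLp y : Fin N → ℝ)

theorem supNorm_frameMap_le {d N : ℕ} {A : Fin d → Euc N} {R : ℝ} (hR : 0 ≤ R)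
    (hA : ∑ j, ∑ i, (A j i) ^ 2 ≤ R ^ 2) (v : Euc d) :
    supNorm (frameMap A v) ≤ R * ‖v‖ := by
  refine supNorm_le (by positivity) fun i => ?_
  rw [frameMap_apply_coord]
  refine abs_le_of_sq_le_sq ?_ (by positivity)
  refine (Finset.sum_mul_sq_le_sq_mul_sq _ _ _).trans ?_
  rw [mul_pow, EuclideanSpace.real_norm_sq_eq, mul_comm]
  gcongr
  refine le_trans (Finset.sum_le_sum fun j _ => ?_) hA
  exact Finset.single_le_sum (f := fun i => (A j i) ^ 2) (fun i _ => sq_nonneg _)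
    (Finset.mem_univ i)

/-- The transfer to the Grassmann manifold needs an open exceptional set. -/
theorem isClosed_wellSpread (d N h : ℕ) (t T : ℝ) :
    IsClosed {A : Fin d → Euc N | WellSpread A t T h} := by
  unfold WellSpread
  have h1 : ∀ x : Euc d, Continuous fun A : Fin d → Euc N => supNorm (frameMap A x) := by
    intro x
    refine continuous_norm.comp ((PiLp.continuous_ofLp 2 _).comp ?_)
    simp only [frameMap_apply]
    fun_prop
  refine IsClosed.inter (s₁ := {A | ∀ x, t * ‖x‖ ≤ supNorm (frameMap A x)}) ?_ ?_
  · simp only [Set.ofPred_forall]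
    exact isClosed_iInter fun x => isClosed_le continuous_const (h1 x)
  · have h2 : {A : Fin d → Euc N | ∃ e : Fin h ↪ Fin d, ∀ i, ∑ r, (A (e r) i) ^ 2 ≤ T ^ 2}
        = ⋃ e : Fin h ↪ Fin d, ⋂ i, {A | ∑ r, (A (e r) i) ^ 2 ≤ T ^ 2} := by
      ext A
      simp
    change IsClosed {A : Fin d → Euc N | ∃ e : Fin h ↪ Fin d, ∀ i, ∑ r, (A (e r) i) ^ 2 ≤ T ^ 2}
    rw [h2]
    exact isClosed_iUnion_of_finite fun e => isClosed_iInter fun i =>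
      isClosed_le (by fun_prop) continuous_const

/-- The vector of `ℝ^d` with the given integer coordinates. -/
def intVec {d : ℕ} (z : Fin d → ℤ) : Euc d := WithLp.toLp 2 fun j => (z j : ℝ)

/-- The nonzero integer vectors with coordinates in `[-K, K]`. -/
def intBox (d K : ℕ) : Finset (Fin d → ℤ) :=
  (Fintype.piFinset fun _ => Finset.Icc (-(K : ℤ)) K).filter fun z => z ≠ 0

theorem card_intBox_le (d K : ℕ) : ((intBox d K).card : ℝ) ≤ (2 * K + 1) ^ d := by
  have h : (intBox d K).card ≤ (2 * K + 1) ^ d := by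
    refine (Finset.card_filter_le _ _).trans ?_
    rw [Fintype.card_piFinset]
    simp only [Int.card_Icc, Finset.prod_const, Finset.card_univ, Fintype.card_fin]
    gcongr
    omega
  exact_mod_cast h

theorem intVec_ne_zero {d : ℕ} {z : Fin d → ℤ} (hz : z ≠ 0) : intVec z ≠ 0 := by
  intro h
  apply hz
  ext j
  have := congrArg (fun v : Euc d => v j) h
  simpa [intVec] using this

/-- Each coordinate of `K u` is rounded down, with error at most 1; `K > √d` prevents the result
from being zero. -/
theorem exists_intBox_approx {d K : ℕ} (hK : √d < K) {u : Euc d} (hu : ‖u‖ = 1) :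
    ∃ z ∈ intBox d K, ‖(K : ℝ) • u - intVec z‖ ≤ √d := by
  let z : Fin d → ℤ := fun j => ⌊(K : ℝ) * u j⌋
  have happ : ‖(K : ℝ) • u - intVec z‖ ≤ √d := by
    refine le_of_sq_le_sq ?_ (Real.sqrt_nonneg _)
    rw [EuclideanSpace.real_norm_sq_eq, Real.sq_sqrt (by positivity)]
    have : ∀ j ∈ Finset.univ, (((K : ℝ) • u - intVec z) j) ^ 2 ≤ 1 := by
      intro j _
      have h1 : ((K : ℝ) • u - intVec z) j = Int.fract ((K : ℝ) * u j) := rfl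
      rw [h1]
      have h2 := Int.fract_nonneg ((K : ℝ) * u j)
      have h3 := (Int.fract_lt_one ((K : ℝ) * u j)).le
      exact pow_le_one₀ h2 h3
    simpa using Finset.sum_le_card_nsmul _ _ _ this
  refine ⟨z, ?_, happ⟩
  rw [intBox, Finset.mem_filter, Fintype.mem_piFinset]
  constructor
  · intro j
    have h1 : |u j| ≤ 1 := by
      rw [← hu]
      exact PiLp.norm_apply_le u j
    have h2 : (0 : ℝ) ≤ K := by positivity
    rw [abs_le] at h1
    rw [Finset.mem_Icc]
    constructor
    · rw [Int.le_floor]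
      push_cast
      nlinarith
    · have : (⌊(K : ℝ) * u j⌋ : ℝ) ≤ K := (Int.floor_le _).trans (by nlinarith)
      exact_mod_cast this
  · intro hz
    have h1 : intVec z = 0 := by
      rw [hz]
      ext j
      simp [intVec]
    rw [h1, sub_zero, norm_smul, hu, mul_one] at happ
    simp only [Real.norm_natCast] at happ
    exact absurd happ (not_le.2 hK)

/-- A lower bound at the integer vectors in a box gives one at all vectors. -/
theorem le_supNorm_frameMap_of_intBox {d N : ℕ} (hN : 1 ≤ N) (hd : d ^ 2 ≤ N)
    {A : Fin d → Euc N} {t : ℝ} (ht : 1 ≤ t) (hA : ∑ j, ∑ i, (A j i) ^ 2 ≤ 16 * (N * d))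
    (hz : ∀ z ∈ intBox d (16 * N), t * ‖intVec z‖ ≤ supNorm (frameMap A (intVec z)))
    (x : Euc d) : t / 2 * ‖x‖ ≤ supNorm (frameMap A x) := by
  have hN' : (1 : ℝ) ≤ N := by exact_mod_cast hN
  have hd' : (d : ℝ) ^ 2 ≤ N := by exact_mod_cast hd
  have hdN : (d : ℝ) ≤ N := by exact_mod_cast (Nat.le_self_pow two_ne_zero d).trans hd
  have hsd : √d ≤ N := by
    rw [Real.sqrt_le_left (by positivity)]
    nlinarith
  have hunit : ∀ u : Euc d, ‖u‖ = 1 → t / 2 ≤ supNorm (frameMap A u) := by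
    intro u hu
    -- At scale `16 N` the rounding error contributes at most `4 √(N d) √d ≤ 4 N`, because `d ^ 2 ≤
    -- N`. This leaves `(15 t - 4) / 16`, which is at least `t / 2` as `t ≥ 1`.
    obtain ⟨z, hzb, hzu⟩ := exists_intBox_approx (K := 16 * N)
      (by push_cast; linarith) hu
    have h1 := hz z hzb
    set v := ((16 * N : ℕ) : ℝ) • u - intVec z with hv
    have h2 : frameMap A (intVec z) = ((16 * N : ℕ) : ℝ) • frameMap A u + (-1 : ℝ) • frameMap A v := by
      rw [hv, map_sub, map_smul]
      module
    have h3 : supNorm (frameMap A (intVec z))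
        ≤ 16 * N * supNorm (frameMap A u) + supNorm (frameMap A v) := by
      rw [h2]
      refine (supNorm_add_le _ _).trans (le_of_eq ?_)
      rw [supNorm_smul, supNorm_smul]
      simp
    have h4 : supNorm (frameMap A v) ≤ 4 * N := by
      have hR : ∑ j, ∑ i, (A j i) ^ 2 ≤ (4 * √(N * d)) ^ 2 := by
        rw [mul_pow, Real.sq_sqrt (by positivity)]
        linarith
      refine (supNorm_frameMap_le (by positivity) hR v).trans ?_
      calc 4 * √(N * d) * ‖v‖ ≤ 4 * √(N * d) * √d := by gcongr
        _ = 4 * √(N * d * d) := by rw [mul_assoc, ← Real.sqrt_mul (by positivity)]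
        _ ≤ 4 * N := by
            gcongr
            rw [Real.sqrt_le_left (by positivity)]
            nlinarith
    have h5 : 16 * N - √d ≤ ‖intVec z‖ := by
      have h6 : ‖((16 * N : ℕ) : ℝ) • u‖ ≤ ‖intVec z‖ + ‖v‖ := by
        refine (le_of_eq ?_).trans (norm_add_le (intVec z) v)
        rw [hv]
        congr 1
        abel
      rw [norm_smul, hu, mul_one, Real.norm_natCast] at h6
      push_cast at h6
      linarith
    have h7 : t * (15 * N) ≤ t * ‖intVec z‖ := by
      gcongr
      linarith
    have h8 : t * (15 * N) ≤ 16 * N * supNorm (frameMap A u) + 4 * N := by linarith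
    have h9 : (15 * t - 4) ≤ 16 * supNorm (frameMap A u) := by
      refine le_of_mul_le_mul_right ?_ (by linarith : (0 : ℝ) < N)
      linarith
    linarith
  rcases eq_or_ne x 0 with rfl | hx
  · simp [supNorm]
  · have hx' : 0 < ‖x‖ := norm_pos_iff.2 hx
    have h1 := hunit (‖x‖⁻¹ • x) (by rw [norm_smul, norm_inv, norm_norm, inv_mul_cancel₀ hx'.ne'])
    rw [map_smul, supNorm_smul, abs_of_pos (by positivity), ← div_eq_inv_mul,
      le_div_iff₀ hx'] at h1
    exact h1

/-! ### Probabilities of the bad events -/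

theorem measureReal_sum_sq_finset_le {d N : ℕ} (Q : Finset (Fin d × Fin N)) (u : ℝ) :
    (gaussFrame d N).real {A | u ≤ ∑ p ∈ Q, (A p.1 p.2) ^ 2} ≤ Real.exp (Q.card - u / 4) := by
  classical
  have key : ∀ F : Fin d → Fin N → ℝ,
      ∑ j, ∑ i ∈ Finset.univ.filter (fun i => (j, i) ∈ Q), F j i = ∑ p ∈ Q, F p.1 p.2 := by
    intro F
    simp only [Finset.sum_filter]
    rw [← Fintype.sum_prod_type' (f := fun j i => if (j, i) ∈ Q then F j i else 0)]
    simp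
  have h := measureReal_sum_sq_le (fun j => Finset.univ.filter fun i : Fin N => (j, i) ∈ Q) u
  have h1 := key fun _ _ => 1
  simp only [Finset.sum_const, nsmul_eq_mul, mul_one] at h1
  rw [h1] at h
  simpa only [key fun j i => (_ : Fin d → Euc N) j i ^ 2] using h

/-- It is unlikely that for each of `m` disjoint blocks of `h` coordinates some row of a Gaussian
matrix has a large projection onto the block. -/
theorem measureReal_forall_block_le {d N m h : ℕ} (e : Fin m × Fin h ↪ Fin d) (u : ℝ) :
    (gaussFrame d N).real {A | ∀ b, ∃ i, u ≤ ∑ r, (A (e (b, r)) i) ^ 2}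
      ≤ N ^ m * Real.exp (m * h - m * u / 4) := by
  -- A bad row is chosen for each block. Disjointness of the blocks makes the `m * h` selected
  -- entries distinct, so one Chernoff bound covers each of the `N ^ m` choices.
  let q : (Fin m → Fin N) → Fin m × Fin h ↪ Fin d × Fin N := fun f =>
    ⟨fun p => (e p, f p.1), fun p p' hp => e.injective (congrArg Prod.fst hp)⟩
  have hsub : {A : Fin d → Euc N | ∀ b, ∃ i, u ≤ ∑ r, (A (e (b, r)) i) ^ 2}
      ⊆ ⋃ f : Fin m → Fin N, {A | m * u ≤ ∑ p ∈ Finset.univ.map (q f), (A p.1 p.2) ^ 2} := by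
    intro A hA
    choose f hf using hA
    refine Set.mem_iUnion.2 ⟨f, ?_⟩
    rw [Set.mem_ofPred_eq, Finset.sum_map, Fintype.sum_prod_type]
    have := Finset.card_nsmul_le_sum Finset.univ _ u fun b _ => hf b
    rw [Finset.card_univ, Fintype.card_fin, nsmul_eq_mul] at this
    exact this
  refine (measureReal_mono hsub).trans ((measureReal_iUnion_fintype_le _).trans ?_)
  refine (Finset.sum_le_card_nsmul _ _ (Real.exp (m * h - m * u / 4)) fun f _ => ?_).trans ?_
  · have := measureReal_sum_sq_finset_le (Finset.univ.map (q f)) (m * u)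
    simpa using this
  · simp

theorem measureReal_exists_intBox_le {d N : ℕ} (K : ℕ) {t : ℝ} (ht : 0 < t) :
    (gaussFrame d N).real {A | ∃ z ∈ intBox d K, supNorm (frameMap A (intVec z)) < t * ‖intVec z‖}
      ≤ (2 * K + 1) ^ d * Real.exp (-(N * (Real.exp (-t ^ 2) / 9))) := by
  have hset : {A : Fin d → Euc N | ∃ z ∈ intBox d K,
        supNorm (frameMap A (intVec z)) < t * ‖intVec z‖}
      = ⋃ z ∈ intBox d K, {A | supNorm (frameMap A (intVec z)) < t * ‖intVec z‖} := by
    ext A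
    simp
  rw [hset]
  refine (measureReal_biUnion_finset_le _ _).trans ?_
  refine (Finset.sum_le_card_nsmul _ _ _ fun z hz =>
    measureReal_supNorm_frameMap_lt_le (intVec_ne_zero (Finset.mem_filter.1 hz).2) ht).trans ?_
  rw [nsmul_eq_mul]
  gcongr
  exact card_intBox_le d K

/-- The three terms bound a large Hilbert-Schmidt norm, a failed lower bound at some integer vector,
and a large row on every block. -/
theorem measureReal_not_wellSpread_le {d N m h : ℕ} (hN : 1 ≤ N) (hd : d ^ 2 ≤ N)
    (e : Fin m × Fin h ↪ Fin d) {t T : ℝ} (ht : 1 ≤ t) :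
    (gaussFrame d N).real {A | ¬ WellSpread A (t / 2) T h}
      ≤ Real.exp (-(3 * (N * d)))
        + (32 * N + 1) ^ d * Real.exp (-(N * (Real.exp (-t ^ 2) / 9)))
        + N ^ m * Real.exp (m * h - m * T ^ 2 / 4) := by
  have hsub : {A : Fin d → Euc N | ¬ WellSpread A (t / 2) T h}
      ⊆ ({A | 16 * (N * d) ≤ ∑ p : Fin d × Fin N, (A p.1 p.2) ^ 2}
        ∪ {A | ∃ z ∈ intBox d (16 * N),
            supNorm (frameMap A (intVec z)) < t * ‖intVec z‖})
        ∪ {A | ∀ b, ∃ i, T ^ 2 ≤ ∑ r, (A (e (b, r)) i) ^ 2} := by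
    intro A hA
    by_contra hcon
    simp only [Set.mem_union, Set.mem_ofPred_eq, not_or, not_exists, not_and, not_le, not_lt,
      not_forall] at hcon
    obtain ⟨⟨h1, h2⟩, b, h3⟩ := hcon
    refine hA ⟨le_supNorm_frameMap_of_intBox hN hd ht ?_ h2, ?_⟩
    · rw [Fintype.sum_prod_type] at h1
      exact h1.le
    · exact ⟨⟨fun r => e (b, r), fun r r' hr => by simpa using e.injective hr⟩,
        fun i => (h3 i).le⟩
  refine (measureReal_mono hsub).trans ((measureReal_union_le _ _).trans ?_)
  refine add_le_add ((measureReal_union_le _ _).trans (add_le_add ?_ ?_)) ?_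
  · refine (measureReal_sum_sq_finset_le _ _).trans (Real.exp_le_exp.2 (le_of_eq ?_))
    simp only [Finset.card_univ, Fintype.card_prod, Fintype.card_fin]
    push_cast
    ring
  · have := measureReal_exists_intBox_le (d := d) (N := N) (16 * N) (zero_lt_one.trans_le ht)
    refine this.trans (le_of_eq ?_)
    push_cast
    ring
  · exact measureReal_forall_block_le e (T ^ 2)

/-! ### Choice of the parameters -/

theorem eventually_log_le :
    ∀ᶠ N : ℕ in atTop, Real.log N + 7 ≤ (N : ℝ) ^ (1 / 4 : ℝ) / 9 ∧ 4 ≤ Real.log N := by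
  have h1 : ∀ᶠ x : ℝ in atTop, ‖Real.log x‖ ≤ 1 / 18 * ‖x ^ (1 / 4 : ℝ)‖ :=
    (isLittleO_log_rpow_atTop (by norm_num)).bound (by norm_num)
  have h2 : ∀ᶠ x : ℝ in atTop, 126 ≤ x ^ (1 / 4 : ℝ) :=
    (tendsto_rpow_atTop (by norm_num)).eventually_ge_atTop _
  have h3 : ∀ᶠ x : ℝ in atTop, 4 ≤ Real.log x := Real.tendsto_log_atTop.eventually_ge_atTop _
  filter_upwards [tendsto_natCast_atTop_atTop.eventually h1,
    tendsto_natCast_atTop_atTop.eventually h2, tendsto_natCast_atTop_atTop.eventually h3]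
    with N h1 h2 h3
  refine ⟨?_, h3⟩
  rw [Real.norm_eq_abs, Real.norm_eq_abs, abs_of_nonneg (by linarith),
    abs_of_nonneg (by linarith)] at h1
  linarith

/-- Take `h = min(d, ⌈log N⌉)` and `m = ⌊d / h⌋`; as `h ≤ d`, the blocks cover at least half of the
coordinates. -/
theorem exists_block_embedding {d N : ℕ} (hd1 : 1 ≤ d) (hL : 4 ≤ Real.log N) :
    ∃ m h : ℕ, Nonempty (Fin m × Fin h ↪ Fin d) ∧ min (Real.log N) d ≤ h ∧
      (h : ℝ) ≤ 2 * Real.log N ∧ (d : ℝ) ≤ 2 * (m * h) := by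
  set h := min d ⌈Real.log N⌉₊ with hh
  have hpos : 0 < h := lt_min hd1 (Nat.ceil_pos.2 (by linarith))
  have hmod := Nat.div_add_mod d h
  have hlt := Nat.mod_lt d hpos
  have hm1 : 1 ≤ d / h := (Nat.one_le_div_iff hpos).2 (min_le_left _ _)
  refine ⟨d / h, h, ?_, ?_, ?_, ?_⟩
  · have hle : d / h * h ≤ d := Nat.div_mul_le_self d h
    exact ⟨finProdFinEquiv.toEmbedding.trans (Fin.castLEEmb hle)⟩
  · rw [hh, Nat.cast_min, min_comm]
    exact min_le_min le_rfl (Nat.le_ceil _)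
  · have h1 : (h : ℝ) ≤ ⌈Real.log N⌉₊ := by exact_mod_cast min_le_right _ _
    have h2 := Nat.ceil_lt_add_one (by linarith : 0 ≤ Real.log N)
    linarith
  · have : d ≤ 2 * (d / h * h) := by nlinarith
    exact_mod_cast this

theorem measureReal_not_wellSpread_le_exp {d N m h : ℕ} (hN : 1 ≤ N) (hd1 : 1 ≤ d)
    (hd : d ^ 2 ≤ N) (hlog : Real.log N + 7 ≤ (N : ℝ) ^ (1 / 4 : ℝ) / 9) (hL : 4 ≤ Real.log N)
    (e : Fin m × Fin h ↪ Fin d) (hh : (h : ℝ) ≤ 2 * Real.log N)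
    (hm : (d : ℝ) ≤ 2 * (m * h)) :
    (gaussFrame d N).real
        {A | ¬ WellSpread A (√(Real.log N) / 2 / 2) (10 * √(Real.log N)) h}
      ≤ Real.exp (-1) ^ d := by
  have hN' : (1 : ℝ) ≤ N := by exact_mod_cast hN
  have hN0 : (0 : ℝ) < N := by linarith
  have hd1' : (1 : ℝ) ≤ d := by exact_mod_cast hd1
  have hd' : (d : ℝ) ^ 2 ≤ N := by exact_mod_cast hd
  set L := Real.log N with hLdef
  have hL0 : 0 ≤ L := by linarith
  have ht : 1 ≤ √L / 2 := by
    have : (2 : ℝ) ≤ √L := Real.le_sqrt_of_sq_le (by linarith)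
    linarith
  have hexpL : Real.exp L = N := Real.exp_log hN0
  have hb1 : Real.exp (-(3 * (N * d))) ≤ Real.exp (-(3 * d)) := by
    rw [Real.exp_le_exp]
    nlinarith
  -- With `t = √L / 2` one has `N e^{-t^2} = N^{3/4}`. Of this `N^{1/2} ≥ d`, and the remaining
  -- `N^{1/4}` beats the logarithmic cost per dimension of the box.
  have hb2 : (32 * N + 1 : ℝ) ^ d * Real.exp (-(N * (Real.exp (-(√L / 2) ^ 2) / 9)))
      ≤ Real.exp (-(3 * d)) := by
    have h1 : (32 * N + 1 : ℝ) ≤ Real.exp (L + 4) := by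
      have h2 : (33 : ℝ) ≤ Real.exp 4 := by
        have h3 : Real.exp 4 = Real.exp 1 ^ 4 := by
          rw [← Real.exp_nat_mul]
          norm_num
        have h4 : (2.7 : ℝ) ≤ Real.exp 1 := by linarith [Real.exp_one_gt_d9]
        rw [h3]
        refine le_trans ?_ (pow_le_pow_left₀ (by norm_num) h4 4)
        norm_num
      rw [Real.exp_add, hexpL]
      nlinarith
    have h5 : Real.exp (-(√L / 2) ^ 2) = (N : ℝ) ^ (-(1 / 4) : ℝ) := by
      rw [Real.rpow_def_of_pos hN0, div_pow, Real.sq_sqrt hL0]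
      congr 1
      ring
    have h6 : (N : ℝ) * (N : ℝ) ^ (-(1 / 4) : ℝ) = (N : ℝ) ^ (1 / 2 : ℝ) * (N : ℝ) ^ (1 / 4 : ℝ) := by
      rw [← Real.rpow_add hN0, ← Real.rpow_one_add' hN0.le (by norm_num)]
      norm_num
    have h7 : (d : ℝ) ≤ (N : ℝ) ^ (1 / 2 : ℝ) := by
      rw [← Real.sqrt_eq_rpow]
      exact Real.le_sqrt_of_sq_le hd'
    have h8 : (d : ℝ) * (L + 7) ≤ (N : ℝ) ^ (1 / 2 : ℝ) * ((N : ℝ) ^ (1 / 4 : ℝ) / 9) := by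
      gcongr
    calc (32 * N + 1 : ℝ) ^ d * Real.exp (-(N * (Real.exp (-(√L / 2) ^ 2) / 9)))
        ≤ Real.exp (L + 4) ^ d * Real.exp (-(d * (L + 7))) := by
          refine mul_le_mul (pow_le_pow_left₀ (by positivity) h1 d) ?_ (Real.exp_pos _).le
            (by positivity)
          rw [Real.exp_le_exp, neg_le_neg_iff, h5]
          refine h8.trans (le_of_eq ?_)
          rw [← mul_div_assoc, ← mul_div_assoc, h6]
      _ = Real.exp (-(3 * d)) := by
          rw [← Real.exp_nat_mul, ← Real.exp_add]
          congr 1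
          ring
  -- The exponent is at most `m L + 2 m L - 25 m L = -22 m L`, while `3 d ≤ 6 m h ≤ 12 m L`.
  have hb3 : (N : ℝ) ^ m * Real.exp (m * h - m * (10 * √L) ^ 2 / 4) ≤ Real.exp (-(3 * d)) := by
    rw [← hexpL, ← Real.exp_nat_mul, ← Real.exp_add, Real.exp_le_exp, mul_pow,
      Real.sq_sqrt hL0]
    have h1 : (m : ℝ) * h ≤ m * (2 * L) := by gcongr
    have h2 : (0 : ℝ) ≤ m * h := by positivity
    linarith
  have h3 : (3 : ℝ) ≤ Real.exp (2 * d) := by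
    have := Real.add_one_le_exp (2 * (d : ℝ))
    linarith
  refine (measureReal_not_wellSpread_le hN hd e ht).trans ?_
  calc _ ≤ Real.exp (-(3 * d)) + Real.exp (-(3 * d)) + Real.exp (-(3 * d)) :=
        add_le_add (add_le_add hb1 hb2) hb3
    _ = 3 * Real.exp (-(3 * d)) := by ring
    _ ≤ Real.exp (2 * d) * Real.exp (-(3 * d)) := by gcongr
    _ = Real.exp (-1) ^ d := by
        rw [← Real.exp_add, ← Real.exp_nat_mul]
        congr 1
        ring

/-! ### Conclusion for large and for bounded `N` -/

theorem le_grassHaar_of_wellSpread {d N h : ℕ} (hdN : d ≤ N) {t T ε : ℝ} (ht : 0 < t)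
    (hε : 0 < ε) (hε1 : ε < 1)
    (hbad : (gaussFrame d N).real {A | ¬ WellSpread A t T h} ≤ ε) {S : Set (Grass d N)}
    (hS : ∀ A : Fin d → Euc N, WellSpread A t T h → ∀ E : Grass d N,
      E.1 = LinearMap.range (frameMap A) → E ∈ S) :
    ENNReal.ofReal (1 - ε) ≤ grassHaar hdN S := by
  have hle : gaussFrame d N {A | ¬ WellSpread A t T h} ≤ ENNReal.ofReal ε := by
    rw [← ofReal_measureReal]
    exact ENNReal.ofReal_le_ofReal hbad
  have hlt : gaussFrame d N {A | ¬ WellSpread A t T h} < 1 :=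
    hle.trans_lt (by rwa [ENNReal.ofReal_lt_one])
  refine le_trans ?_ (one_sub_le_grassHaar hdN (isClosed_wellSpread d N h t T).isOpen_compl hlt
    (fun A hA => frameMap_injective ht (not_not.1 hA).1) fun A hA => hS A (not_not.1 hA))
  rw [ENNReal.ofReal_sub _ hε.le, ENNReal.ofReal_one]
  exact tsub_le_tsub_left hle 1

/-- Every subspace is the range of a matrix which satisfies the two bounds up to a factor depending
on the dimension `N`. -/
theorem exists_wellSpread {d N : ℕ} (hN : 1 ≤ N) (E : Grass d N) :
    ∃ A : Fin d → Euc N, E.1 = LinearMap.range (frameMap A) ∧ WellSpread A (√N)⁻¹ 1 d := by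
  let b : OrthonormalBasis (Fin d) ℝ E.1 :=
    (stdOrthonormalBasis ℝ E.1).reindex (finCongr E.2)
  have hN0 : (0 : ℝ) < √N := Real.sqrt_pos.2 (by exact_mod_cast hN)
  let A : Fin d → Euc N := fun j => b j
  have hAo : Orthonormal ℝ A := b.orthonormal.comp_linearIsometry E.1.subtypeₗᵢ
  have hmap : ∀ x : Euc d, frameMap A x = b.repr.symm x := by
    intro x
    rw [frameMap_apply, ← b.sum_repr_symm]
    simp [A]
  refine ⟨A, ?_, ?_, Function.Embedding.refl _, ?_⟩
  · ext y
    constructor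
    · intro hy
      exact ⟨b.repr ⟨y, hy⟩, by rw [hmap, LinearIsometryEquiv.symm_apply_apply]⟩
    · rintro ⟨x, rfl⟩
      rw [hmap]
      exact Subtype.prop _
  · intro x
    have h1 : ‖frameMap A x‖ = ‖x‖ := by
      rw [hmap]
      exact b.repr.symm.norm_map x
    rw [← h1, ← div_eq_inv_mul, div_le_iff₀' hN0]
    refine le_of_sq_le_sq ?_ (mul_nonneg hN0.le (supNorm_nonneg _))
    rw [mul_pow, Real.sq_sqrt (by positivity), EuclideanSpace.real_norm_sq_eq]
    have h2 : ∀ i ∈ Finset.univ, (frameMap A x i) ^ 2 ≤ supNorm (frameMap A x) ^ 2 :=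
      fun i _ => sq_le_sq.2 ((abs_le_supNorm _ i).trans (le_abs_self _))
    simpa using Finset.sum_le_card_nsmul _ _ _ h2
  · intro i
    -- Bessel's inequality for the `i`-th unit vector bounds the `i`-th row.
    have h1 := hAo.sum_inner_products_le (x := EuclideanSpace.single i (1 : ℝ))
      (s := Finset.univ)
    simpa [EuclideanSpace.inner_single_right] using h1

end GenericSpaces

end

open GenericSpaces

theorem proposition4p2 :
    ∃ C c ε : ℝ, 0 < C ∧ 0 < c ∧ 0 < ε ∧ ε < 1 ∧
      ∀ (d N : ℕ) (_ : 1 ≤ d) (hdN : d ≤ N) (_ : d ^ 2 ≤ N),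
        ENNReal.ofReal (1 - ε ^ d) ≤ GenericSpaces.grassHaar hdN
          {E : GenericSpaces.Grass d N | GenericSpaces.HasComplementedHilbert
            (GenericSpaces.LOneQuotient E) C (min (c * Real.log N) d)} ∧
        ENNReal.ofReal (1 - ε ^ d) ≤ GenericSpaces.grassHaar hdN
          {E : GenericSpaces.Grass d N | GenericSpaces.HasComplementedHilbert
            (GenericSpaces.linftySubspace E) C (min (c * Real.log N) d)} := by
  obtain ⟨N₀, hN₀⟩ := Filter.eventually_atTop.1 eventually_log_le
  -- For `N ≥ N₀` the constant is `10 √L / (√L / 4) = 40`. For `N ≤ N₀` every `E` qualifies with `h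
  -- = d`, since the maximum and Euclidean norms differ by at most `√N₀`.
  refine ⟨max 40 √N₀, 1, Real.exp (-1), by positivity, one_pos, Real.exp_pos _,
    by simp, ?_⟩
  intro d N hd1 hdN hd
  rw [one_mul]
  have hN : 1 ≤ N := hd1.trans hdN
  have hε1 : Real.exp (-1) ^ d < 1 :=
    pow_lt_one₀ (Real.exp_pos _).le (by simp) (by omega)
  rcases le_total N₀ N with hNN | hNN
  · obtain ⟨hlog, hL⟩ := hN₀ N hNN
    obtain ⟨m, h, ⟨e⟩, hmin, hh, hm⟩ := exists_block_embedding hd1 hL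
    have hbad := measureReal_not_wellSpread_le_exp hN hd1 hd hlog hL e hh hm
    have hs : 0 < √(Real.log N) := Real.sqrt_pos.2 (by linarith)
    have ht : 0 < √(Real.log N) / 2 / 2 := by positivity
    have hC : 10 * √(Real.log N) / (√(Real.log N) / 2 / 2) ≤ max 40 √N₀ := by
      refine le_trans (le_of_eq ?_) (le_max_left _ _)
      field_simp
      norm_num
    exact ⟨le_grassHaar_of_wellSpread hdN ht (by positivity) hε1 hbad fun A hA E hE =>
        HasComplementedHilbert.lOneQuotient_of_wellSpread ht (by positivity) hA hE hC hmin,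
      le_grassHaar_of_wellSpread hdN ht (by positivity) hε1 hbad fun A hA E hE =>
        HasComplementedHilbert.linftySubspace_of_wellSpread ht (by positivity) hA hE hC hmin⟩
  · have hN0 : 0 < √(N : ℝ) := Real.sqrt_pos.2 (by exact_mod_cast hN)
    have hC : 1 / (√(N : ℝ))⁻¹ ≤ max 40 √N₀ := by
      rw [one_div, inv_inv]
      exact (Real.sqrt_le_sqrt (by exact_mod_cast hNN)).trans (le_max_right _ _)
    have hall : ∀ {S : Set (Grass d N)}, (∀ E, E ∈ S) →
        ENNReal.ofReal (1 - Real.exp (-1) ^ d) ≤ grassHaar hdN S := fun hS => by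
      rw [Set.eq_univ_of_forall hS, measure_univ, ENNReal.ofReal_le_one]
      linarith [pow_pos (Real.exp_pos (-1)) d]
    constructor
    · refine hall fun E => ?_
      obtain ⟨A, hE, hA⟩ := exists_wellSpread hN E
      exact HasComplementedHilbert.lOneQuotient_of_wellSpread (inv_pos.2 hN0) zero_le_one hA hE
        hC (min_le_right _ _)
    · refine hall fun E => ?_
      obtain ⟨A, hE, hA⟩ := exists_wellSpread hN E
      exact HasComplementedHilbert.linftySubspace_of_wellSpread (inv_pos.2 hN0) zero_le_one hA hE
        hC (min_le_right _ _)
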